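/- Let $\Omega=(l,r)\subset\mathbb R$ be a bounded open interval, $b\in\mathbb R\setminus\{0\}$ a constant velocity and $f\in L^2(\Omega)$. For an open interval $D$ with outward unit normal $n$ (equal to $-1$ at the left and $+1$ at the right end point), let $\partial_\pm D$ be the set of end points where $\pm b\,n>0$, let $H^1_+(D)=\{v\in H^1(D): v=0 \text{ on }\partial_+D\}$, and write $(v,w)_D=\int_D vw$, $\|v\|_D=(v,v)_D^{1/2}$, with $D$ dropped when $D=\Omega$. Let $u\in L^2(\Omega)$ be the ultra-weak solution of $b\,u'=f$ in $\Omega$, $u=0$ on $\partial_-\Omega$, i.e. $-(u,b\,v')=(f,v)$ for all $v\in H^1_+(\Omega)$. Let $\mathcal T_h$ be a mesh of $\Omega$ with vertices $l=x_0<x_1<\dots<x_n=r$ (set $\mathcal V_h$) and elements $(x_{i},x_{i+1})$. For $a\in\mathcal V_h$ let $\psi_a$ be the continuous piecewise affine hat function with value $1$ at $a$ and $0$ at all other vertices, $\mathcal T_a$ the set of elements having $a$ as a vertex, $\omega_a$ the corresponding open interval, and $h_{\omega_a}$ its length. $\mathbb P_k(\mathcal T_h)$ and $\mathbb P_k(\mathcal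 T_a)$ are the (possibly discontinuous) piecewise polynomials of degree at most $k$. Let $k'\ge k\ge 0$, and let $u_h\in\mathbb P_k(\mathcal T_h)$ satisfy $$(f,\psi_a)_{\omega_a}+(u_h,b\,\psi_a')_{\omega_a}=0\qquad\text{for all } a\in\mathcal V_h\setminus\partial_+\Omega .$$ For every $a\in\mathcal V_h$ let $s_h^a\in\mathbb P_{k'}(\mathcal T_a)\cap H^1(\omega_a)$ solve $$(b(\psi_a s_h^a)',v_h)_{\omega_a}=(f\psi_a+b\,\psi_a'u_h,v_h)_{\omega_a}\qquad\text{for all } v_h\in\mathbb P_{k'}(\mathcal T_a),$$ and set $s_h=\sum_{a\in\mathcal V_h}\psi_a s_h^a$. Assume in addition that $\psi_a f\in\mathbb P_{k'}(\mathcal T_a)$ for all $a\in\mathcal V_h$. For $a\in\mathcal V_h$ call $C_{\mathrm{PF},\omega_a}$ a Poincaré–Friedrichs constant on $\omega_a$ if $$\|v\|_{\omega_a}\le h_{\omega_a}C_{\mathrm{PF},\omega_a}\|v'\|_{\omega_a}$$ for all $v\in H^1(\omega_a)$ with $(v,1)_{\omega_a}=0$ when $a\notin\partial_+\Omega$, and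 for all $v\in H^1_+(\omega_a)$ when $a\in\partial_+\Omega$. Then $C_{\mathrm{PF},\omega_a}=1$ is such a constant for every $a$, and for any choice of Poincaré–Friedrichs constants $C_{\mathrm{PF},\omega_a}$, $a\in\mathcal V_h$, $$\|u_h-s_h\|\le 2\,C_{\mathrm{cont,PF}}\,\|u-u_h\|,\qquad C_{\mathrm{cont,PF}}=\max_{a\in\mathcal V_h}\bigl(1+C_{\mathrm{PF},\omega_a}h_{\omega_a}\|\psi_a'\|_{\infty}\bigr).$$ -/

import Mathlib

open MeasureTheory Set

noncomputable section

namespace Advection1D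

/-- The `L²` inner product `(v, w)_D = ∫_D v w`. -/
def ip (D : Set ℝ) (v w : ℝ → ℝ) : ℝ := ∫ x in D, v x * w x

/-- The `L²` norm `‖v‖_D = √(v, v)_D`. -/
def nrm (D : Set ℝ) (v : ℝ → ℝ) : ℝ := Real.sqrt (ip D v v)

/-- Square integrability on `D`. -/
def InL2 (D : Set ℝ) (v : ℝ → ℝ) : Prop := MemLp v 2 (volume.restrict D)

/-- `g` is the weak derivative of `v` on the open interval `(l, r)`. -/
def IsWeakDeriv (l r : ℝ) (v g : ℝ → ℝ) : Prop :=
  ∀ φ : ℝ → ℝ, ContDiff ℝ (⊤ : ℕ∞) φ → HasCompactSupport φ → tsupport φ ⊆ Ioo l r →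
    ∫ x in Ioo l r, v x * deriv φ x = -∫ x in Ioo l r, g x * φ x

/-- `v ∈ H¹(l, r)` with weak derivative `g`. An element of `H¹(l, r)` is represented by the
representative that is continuous on `[l, r]`, so that its traces are its values at the
end points. -/
structure IsH1 (l r : ℝ) (v g : ℝ → ℝ) : Prop where
  cont : ContinuousOn v (Icc l r)
  memL2 : InL2 (Ioo l r) v
  grad_memL2 : InL2 (Ioo l r) g
  weak : IsWeakDeriv l r v g

/-- The outflow boundary of `(l, r)` for the velocity `b`: the end points where `b * n > 0`,
the outward normal being `-1` at `l` and `1` at `r`. -/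
def outflow (b l r : ℝ) : Set ℝ := {x | (x = l ∧ 0 < b * (-1)) ∨ (x = r ∧ 0 < b * 1)}

/-- `v ∈ H¹₊(l, r)`, the functions of `H¹(l, r)` with zero trace on the outflow boundary;
`g` is the weak derivative of `v`. -/
def IsH1Plus (b l r : ℝ) (v g : ℝ → ℝ) : Prop :=
  IsH1 l r v g ∧ ∀ x ∈ outflow b l r, v x = 0

/-- `u ∈ L²(l, r)` solves the ultra-weak form of `b u' = f` in `(l, r)`, `u = 0` on the inflow
boundary: `-(u, b v') = (f, v)` for all `v ∈ H¹₊(l, r)`. -/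
def IsUltraWeakSolution (b l r : ℝ) (f u : ℝ → ℝ) : Prop :=
  InL2 (Ioo l r) u ∧
    ∀ v g : ℝ → ℝ, IsH1Plus b l r v g →
      -ip (Ioo l r) u (fun x => b * g x) = ip (Ioo l r) f v

/-- A mesh of `(l, r)`: vertices `l = x₀ < x₁ < ⋯ < xₙ = r`; its elements are the intervals
`(x_i, x_{i+1})`, `i < n`. -/
structure Mesh (l r : ℝ) where
  n : ℕ
  node : Fin (n + 1) → ℝ
  strictMono : StrictMono node
  first : node 0 = l
  last : node (Fin.last n) = r

namespace Mesh

variable {l r : ℝ} (T : Mesh l r)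

/-- The (open) element with index `i`. -/
def elem (i : Fin T.n) : Set ℝ := Ioo (T.node i.castSucc) (T.node i.succ)

/-- Left end of the patch of the vertex `a`: the preceding vertex, or `a` if there is none. -/
def patchLeft (a : Fin (T.n + 1)) : ℝ := T.node ⟨a.val - 1, by omega⟩

/-- Right end of the patch of the vertex `a`: the following vertex, or `a` if there is none. -/
def patchRight (a : Fin (T.n + 1)) : ℝ := T.node ⟨min (a.val + 1) T.n, by omega⟩

/-- The open subdomain `ω_a` covered by the elements that share the vertex `a`. -/
def patch (a : Fin (T.n + 1)) : Set ℝ := Ioo (T.patchLeft a) (T.patchRight a)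

/-- The diameter of `ω_a`. -/
def patchDiam (a : Fin (T.n + 1)) : ℝ := T.patchRight a - T.patchLeft a

/-- (Indices of) the elements that share the vertex `a`. -/
def patchElems (a : Fin (T.n + 1)) : Set (Fin T.n) := {i | i.castSucc = a ∨ i.succ = a}

/-- The piecewise affine hat function `ψ_a`. -/
def hat (a : Fin (T.n + 1)) (x : ℝ) : ℝ :=
  if x < T.patchLeft a ∨ T.patchRight a < x then 0
  else if x < T.node a then (x - T.patchLeft a) / (T.node a - T.patchLeft a)
  else if T.node a < x then (T.patchRight a - x) / (T.patchRight a - T.node a)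
  else 1

/-- `‖∇ψ_a‖_∞`; the classical derivative of `ψ_a` exists off the vertices and is its weak
derivative. -/
def hatGradSup (a : Fin (T.n + 1)) : ℝ :=
  (eLpNorm (deriv (T.hat a)) ⊤ (volume.restrict (T.patch a))).toReal

/-- `v` is, on each of the elements with index in `I`, (almost everywhere equal to) a polynomial
of degree at most `k`; neighbouring polynomials need not match. -/
def IsPiecewisePoly (I : Set (Fin T.n)) (k : ℕ) (v : ℝ → ℝ) : Prop :=
  ∀ i ∈ I, ∃ p : Polynomial ℝ, p.natDegree ≤ k ∧
    ∀ᵐ x ∂(volume.restrict (T.elem i)), v x = p.eval x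

/-- The space `ℙ_k(𝒯_h)`. -/
def InPh (k : ℕ) (v : ℝ → ℝ) : Prop := T.IsPiecewisePoly univ k v

/-- The local test space `Y_h^a = ℙ_{k'}(𝒯_a)`. -/
def InYh (k' : ℕ) (a : Fin (T.n + 1)) (v : ℝ → ℝ) : Prop :=
  T.IsPiecewisePoly (T.patchElems a) k' v

/-- The local trial space `X_h^a = ℙ_{k'}(𝒯_a) ∩ H¹(ω_a)`. -/
def InXh (k' : ℕ) (a : Fin (T.n + 1)) (s : ℝ → ℝ) : Prop :=
  T.IsPiecewisePoly (T.patchElems a) k' s ∧ ∃ g, IsH1 (T.patchLeft a) (T.patchRight a) s g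

/-- `v`, with weak derivative `g`, lies in the space on `ω_a` in which the Poincaré–Friedrichs
inequality is used: mean value zero if `a` is not on the outflow boundary of `(l, r)`, and zero
trace on the outflow boundary of `ω_a` if it is. -/
def InYtilde (b : ℝ) (a : Fin (T.n + 1)) (v g : ℝ → ℝ) : Prop :=
  IsH1 (T.patchLeft a) (T.patchRight a) v g ∧
    (T.node a ∉ outflow b l r → ip (T.patch a) v (fun _ => 1) = 0) ∧
    (T.node a ∈ outflow b l r →
      ∀ x ∈ outflow b (T.patchLeft a) (T.patchRight a), v x = 0)

/-- `C` is a constant `C_{PF,ω_a}` in the Poincaré–Friedrichs inequality on `ω_a`. -/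
def IsPFConstant (b : ℝ) (a : Fin (T.n + 1)) (C : ℝ) : Prop :=
  ∀ v g : ℝ → ℝ, T.InYtilde b a v g →
    nrm (T.patch a) v ≤ T.patchDiam a * C * nrm (T.patch a) g

/-- `C_{cont,PF} = max_a (1 + C_{PF,ω_a} h_{ω_a} ‖∇ψ_a‖_∞)`. -/
def Ccont (C : Fin (T.n + 1) → ℝ) : ℝ :=
  Finset.univ.sup' ⟨0, Finset.mem_univ 0⟩
    (fun a : Fin (T.n + 1) => 1 + C a * T.patchDiam a * T.hatGradSup a)

/-- `ψ_a`-orthogonality of the residual of `uh`: it vanishes on `ψ_a` for all interior and inflow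
vertices `a`, that is, for all vertices that are not on the outflow boundary. -/
def HatOrthogonal (b : ℝ) (f uh : ℝ → ℝ) : Prop :=
  ∀ a : Fin (T.n + 1), T.node a ∉ outflow b l r →
    ip (T.patch a) f (T.hat a)
      + ip (T.patch a) uh (fun x => b * deriv (T.hat a) x) = 0

/-- `s ∈ X_h^a` solves the local problem on `ω_a`. The product `ψ_a s` is continuous and piecewise
polynomial, so that its classical derivative, which exists off the vertices, is its weak one. -/
def IsLocalSolution (b : ℝ) (f uh : ℝ → ℝ) (k' : ℕ) (a : Fin (T.n + 1)) (s : ℝ → ℝ) : Prop :=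
  T.InXh k' a s ∧
    ∀ vh : ℝ → ℝ, T.InYh k' a vh →
      ip (T.patch a) (fun x => b * deriv (fun y => T.hat a y * s y) x) vh
        = ip (T.patch a) (fun x => f x * T.hat a x + b * deriv (T.hat a) x * uh x) vh

/-- The global reconstruction `s_h = ∑_a ψ_a s_h^a`. -/
def reconstruction (s : Fin (T.n + 1) → ℝ → ℝ) (x : ℝ) : ℝ := ∑ a, T.hat a x * s a x

end Mesh

end Advection1D

end

noncomputable section

namespace Advection1D

/-! Under the assumption on `ψ_a f` the reconstruction is exact, `s_h = u` almost everywhere, so the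
two norms in the estimate coincide and the factor `2 C_cont,PF ≥ 2` is pure slack.

Exactness: both sides of the local problem are piecewise polynomials in the test space, so testing
with their difference gives `b (ψ_a s_h^a)' = f ψ_a + b ψ_a' u_h` almost everywhere
(`IsLocalSolution.ae_eq`). Integrating this over `Ω`, the `ψ_a`-orthogonality of the residual forces
`ψ_a s_h^a` to vanish at both ends of `Ω` unless `a` is the outflow vertex
(`hat_mul_eq_zero_of_notMem_outflow`). Summing over `a`, with `∑ ψ_a = 1` and `∑ ψ_a' = 0`, shows
that `s_h` satisfies the ultra-weak equation (`integral_reconstruction_mul`). Every test function is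
the derivative of a smooth function vanishing at the outflow end, so the equation determines its
solution (`reconstruction_ae_eq`).

The Poincaré–Friedrichs constant 1 comes from the fundamental theorem of calculus started at a zero
of `v`. For arbitrary constants only their nonnegativity is needed, as it gives `C_cont,PF ≥ 1`. -/

/-! ### Test functions and the du Bois-Reymond lemma. -/

theorem exists_Icc_superset_of_isCompact {l r : ℝ} (hlr : l < r) {K : Set ℝ} (hK : IsCompact K)
    (hsub : K ⊆ Ioo l r) : ∃ c d, l < c ∧ d < r ∧ K ⊆ Icc c d := by
  -- `K` may be empty; the midpoint ensures that a least and a greatest element exist.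
  have hK' : IsCompact (insert ((l + r) / 2) K) := hK.insert _
  have hsub' : insert ((l + r) / 2) K ⊆ Ioo l r :=
    insert_subset ⟨by linarith, by linarith⟩ hsub
  obtain ⟨c, hc⟩ := hK'.exists_isLeast (insert_nonempty _ _)
  obtain ⟨d, hd⟩ := hK'.exists_isGreatest (insert_nonempty _ _)
  exact ⟨c, d, (hsub' hc.1).1, (hsub' hd.1).2,
    fun x hx => ⟨hc.2 (mem_insert_of_mem _ hx), hd.2 (mem_insert_of_mem _ hx)⟩⟩

theorem hasDerivAt_primitive {ξ : ℝ → ℝ} (hξ : Continuous ξ) (e x : ℝ) :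
    HasDerivAt (fun y => ∫ t in e..y, ξ t) (ξ x) x :=
  intervalIntegral.integral_hasDerivAt_right (hξ.intervalIntegrable _ _)
    hξ.stronglyMeasurable.stronglyMeasurableAtFilter hξ.continuousAt

/-- A test function with zero integral is the derivative of a test function. -/
theorem exists_testFunction_deriv_eq {l r : ℝ} (hlr : l < r) {ξ : ℝ → ℝ}
    (hξ : ContDiff ℝ (⊤ : ℕ∞) ξ) (hc : HasCompactSupport ξ) (hs : tsupport ξ ⊆ Ioo l r)
    (h0 : ∫ x, ξ x = 0) :
    ∃ φ : ℝ → ℝ, ContDiff ℝ (⊤ : ℕ∞) φ ∧ HasCompactSupport φ ∧ tsupport φ ⊆ Ioo l r ∧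
      deriv φ = ξ := by
  obtain ⟨c, d, hlc, hdr, hcd⟩ := exists_Icc_superset_of_isCompact hlr hc hs
  have hξ0 : ∀ x, x ∉ Icc c d → ξ x = 0 := fun x hx =>
    image_eq_zero_of_notMem_tsupport (fun h => hx (hcd h))
  have hder : ∀ x, HasDerivAt (fun y => ∫ t in l..y, ξ t) (ξ x) x :=
    hasDerivAt_primitive hξ.continuous l
  have hderiv : deriv (fun y => ∫ t in l..y, ξ t) = ξ := funext fun x => (hder x).deriv
  have htot : ∫ t in l..r, ξ t = 0 := by
    rw [intervalIntegral.integral_eq_integral_of_support_subset, h0]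
    intro x hx
    have := hs (subset_tsupport _ hx)
    exact ⟨this.1, this.2.le⟩
  -- Left of `c` the integrand vanishes; right of `d` the primitive already equals the total
  -- integral, which is zero.
  have hsupp : Function.support (fun y => ∫ t in l..y, ξ t) ⊆ Icc c d := by
    intro x hx
    by_contra hx'
    refine hx ?_
    rcases lt_or_ge x c with h | h
    · refine intervalIntegral.integral_zero_ae (Filter.Eventually.of_forall fun t ht => ?_)
      refine hξ0 t fun h' => ?_
      have := (uIoc_subset_uIcc ht).2
      have := max_lt hlc h
      linarith [h'.1]
    · have hdx : d < x := by
        by_contra h'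
        exact hx' ⟨h, not_lt.1 h'⟩
      have hadd := intervalIntegral.integral_add_adjacent_intervals
        (hξ.continuous.intervalIntegrable (μ := volume) l x)
        (hξ.continuous.intervalIntegrable (μ := volume) x r)
      have hz : ∫ t in x..r, ξ t = 0 := by
        refine intervalIntegral.integral_zero_ae (Filter.Eventually.of_forall fun t ht => ?_)
        refine hξ0 t fun h' => ?_
        have := (uIoc_subset_uIcc ht).1
        have := lt_min hdx hdr
        linarith [h'.2]
      change ∫ t in l..x, ξ t = 0
      linarith
  refine ⟨fun y => ∫ t in l..y, ξ t, ?_, HasCompactSupport.of_support_subset_isCompact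
    isCompact_Icc hsupp, (closure_minimal hsupp isClosed_Icc).trans
      fun x hx => ⟨hlc.trans_le hx.1, hx.2.trans_lt hdr⟩, hderiv⟩
  exact contDiff_infty_iff_deriv.2 ⟨fun x => (hder x).differentiableAt, by rwa [hderiv]⟩

theorem exists_testFunction_integral_eq_one {l r : ℝ} (hlr : l < r) :
    ∃ η : ℝ → ℝ, ContDiff ℝ (⊤ : ℕ∞) η ∧ HasCompactSupport η ∧ tsupport η ⊆ Ioo l r ∧
      ∫ x, η x = 1 := by
  let B : ContDiffBump ((l + r) / 2) := ⟨(r - l) / 8, (r - l) / 4, by linarith, by linarith⟩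
  refine ⟨B.normed volume, B.contDiff_normed, B.hasCompactSupport_normed, ?_, B.integral_normed⟩
  rw [B.tsupport_normed_eq, Real.closedBall_eq_Icc]
  intro x hx
  have h1 : (l + r) / 2 - (r - l) / 4 ≤ x := hx.1
  have h2 : x ≤ (l + r) / 2 + (r - l) / 4 := hx.2
  exact ⟨by linarith, by linarith⟩

/-- The lemma of du Bois-Reymond on a bounded interval. -/
theorem eq_const_of_integral_mul_deriv_eq_zero {l r : ℝ} (hlr : l < r) {w : ℝ → ℝ}
    (hw : ContinuousOn w (Icc l r))
    (h : ∀ φ : ℝ → ℝ, ContDiff ℝ (⊤ : ℕ∞) φ → HasCompactSupport φ → tsupport φ ⊆ Ioo l r →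
      ∫ x in Ioo l r, w x * deriv φ x = 0) :
    ∃ c, ∀ x ∈ Icc l r, w x = c := by
  obtain ⟨η, hη, hηc, hηs, hη1⟩ := exists_testFunction_integral_eq_one hlr
  set c := ∫ x in Ioo l r, w x * η x with hcdef
  have hint : ∀ χ : ℝ → ℝ, Continuous χ → IntegrableOn (fun x => w x * χ x) (Ioo l r) :=
    fun χ hχ => ((hw.mul hχ.continuousOn).integrableOn_Icc).mono_set Ioo_subset_Icc_self
  have hset : ∀ χ g : ℝ → ℝ, tsupport χ ⊆ Ioo l r →
      ∫ x in Ioo l r, g x * χ x = ∫ x, g x * χ x := fun χ g hχ =>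
    setIntegral_eq_integral_of_forall_compl_eq_zero fun x hx => by
      rw [image_eq_zero_of_notMem_tsupport (fun h' => hx (hχ h')), mul_zero]
  have hae : ∀ᵐ x ∂(volume : Measure ℝ), x ∈ Ioo l r → w x - c = 0 := by
    refine isOpen_Ioo.ae_eq_zero_of_integral_contDiff_smul_eq_zero ?_ ?_
    · exact (((hw.sub continuousOn_const).integrableOn_Icc).mono_set
        Ioo_subset_Icc_self).locallyIntegrableOn
    · intro χ hχ hχc hχs
      -- `χ - m η` has zero integral, hence is the derivative of a test function; the hypothesis
      -- then reads `∫ w χ = m c`, that is, `∫ (w - c) χ = 0`.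
      set m := ∫ x, χ x with hm
      have hcomp : HasCompactSupport (fun x => χ x - m * η x) :=
        hχc.sub (hηc.mul_left)
      have hts : tsupport (fun x => χ x - m * η x) ⊆ Ioo l r := by
        refine (tsupport_sub χ (fun x => m * η x)).trans (union_subset hχs ?_)
        exact (tsupport_mul_subset_right (f := fun _ => m) (g := η)).trans hηs
      obtain ⟨φ, h1, h2, h3, h4⟩ := exists_testFunction_deriv_eq hlr
        (hχ.sub (contDiff_const.mul hη)) hcomp hts (by
          rw [integral_sub (hχ.continuous.integrable_of_hasCompactSupport hχc)
            ((hη.continuous.integrable_of_hasCompactSupport hηc).const_mul m),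
            integral_const_mul, hη1, hm]
          ring)
      have h5 := h φ h1 h2 h3
      rw [h4] at h5
      have h6 : ∫ x in Ioo l r, w x * (χ x - m * η x)
          = (∫ x in Ioo l r, w x * χ x) - m * c := by
        rw [hcdef, ← integral_const_mul, ← integral_sub (hint χ hχ.continuous)
          ((hint η hη.continuous).const_mul m)]
        congr 1
        ext x
        ring
      have h7 : ∫ x, χ x • (w x - c) = ∫ x in Ioo l r, (w x - c) * χ x := by
        rw [hset χ (fun x => w x - c) hχs]
        congr 1
        ext x
        simp only [smul_eq_mul]
        ring
      have h8 : ∫ x in Ioo l r, (w x - c) * χ x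
          = (∫ x in Ioo l r, w x * χ x) - c * ∫ x in Ioo l r, χ x := by
        rw [← integral_const_mul, ← integral_sub (hint χ hχ.continuous)]
        · congr 1
          ext x
          ring
        · exact ((hχ.continuous.integrableOn_Icc).mono_set Ioo_subset_Icc_self).const_mul c
      have h9 : ∫ x in Ioo l r, χ x = m := by
        simpa using hset χ (fun _ => 1) hχs
      rw [h7, h8, h9]
      linarith
  refine ⟨c, ?_⟩
  have : w =ᵐ[volume.restrict (Icc l r)] fun _ => c := by
    rw [← restrict_Ioo_eq_restrict_Icc]
    exact (ae_restrict_iff' measurableSet_Ioo).2 (hae.mono fun x hx h' => sub_eq_zero.1 (hx h'))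
  exact Measure.eqOn_Icc_of_ae_eq volume hlr.ne this hw continuousOn_const

/-! ### Calculus in `L²` and `H¹` on an interval. -/

theorem inL2_of_continuousOn {l r : ℝ} {w : ℝ → ℝ} (hw : ContinuousOn w (Icc l r)) :
    InL2 (Ioo l r) w := by
  have hw' := hw.mono Ioo_subset_Icc_self
  rw [InL2, memLp_two_iff_integrable_sq (hw'.aestronglyMeasurable measurableSet_Ioo)]
  exact (hw.pow 2).integrableOn_Icc.mono_set Ioo_subset_Icc_self

theorem InL2.integrableOn {l r : ℝ} {g : ℝ → ℝ} (hg : InL2 (Ioo l r) g) :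
    IntegrableOn g (Ioo l r) :=
  MemLp.integrable one_le_two hg

theorem setIntegral_Ioo_eq {l r : ℝ} (hlr : l ≤ r) (F : ℝ → ℝ) :
    ∫ x in Ioo l r, F x = ∫ x in l..r, F x := by
  rw [intervalIntegral.integral_of_le hlr, integral_Ioc_eq_integral_Ioo]

theorem intervalIntegrable_of_Ioo {l r : ℝ} (hlr : l ≤ r) {F : ℝ → ℝ}
    (hF : IntegrableOn F (Ioo l r)) : IntervalIntegrable F volume l r :=
  (intervalIntegrable_iff_integrableOn_Ioo_of_le hlr).2 hF

theorem eq_zero_of_tsupport_subset_Ioo {l r : ℝ} {φ : ℝ → ℝ} (h : tsupport φ ⊆ Ioo l r) :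
    φ l = 0 ∧ φ r = 0 :=
  ⟨image_eq_zero_of_notMem_tsupport fun h' => (h h').1.ne rfl,
    image_eq_zero_of_notMem_tsupport fun h' => (h h').2.ne rfl⟩

/-- The fundamental theorem of calculus in `H¹`. -/
theorem IsH1.integral_eq_sub {l r : ℝ} (hlr : l < r) {v g : ℝ → ℝ} (h : IsH1 l r v g) {x y : ℝ}
    (hx : x ∈ Icc l r) (hy : y ∈ Icc l r) : ∫ t in x..y, g t = v y - v x := by
  have hg : IntervalIntegrable g volume l r :=
    intervalIntegrable_of_Ioo hlr.le h.grad_memL2.integrableOn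
  have hG : AbsolutelyContinuousOnInterval (fun x => ∫ t in l..x, g t) l r :=
    hg.absolutelyContinuousOnInterval_intervalIntegral left_mem_uIcc
  have hGc : ContinuousOn (fun x => ∫ t in l..x, g t) (Icc l r) := by
    rw [← uIcc_of_le hlr.le]; exact hG.continuousOn
  -- `v` minus the primitive of `g` has zero weak derivative. The primitive is only absolutely
  -- continuous, so integration by parts is used in that class.
  obtain ⟨c, hc⟩ := eq_const_of_integral_mul_deriv_eq_zero hlr (h.cont.sub hGc) (by
    intro φ h1 h2 h3
    have hφ : Continuous (deriv φ) := h1.continuous_deriv (by simp)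
    have hφac : AbsolutelyContinuousOnInterval φ l r :=
      ((h1.of_le (by exact_mod_cast le_top)).contDiffOn).absolutelyContinuousOnInterval
    have hparts := hG.integral_mul_deriv_eq_deriv_mul hφac
    rw [(eq_zero_of_tsupport_subset_Ioo h3).1, (eq_zero_of_tsupport_subset_Ioo h3).2] at hparts
    have hder : ∫ x in l..r, deriv (fun x => ∫ t in l..x, g t) x * φ x
        = ∫ x in l..r, g x * φ x := by
      refine intervalIntegral.integral_congr_ae ?_
      filter_upwards [hg.ae_hasDerivAt_integral] with x hx hx'
      rw [(hx (uIoc_subset_uIcc hx') l left_mem_uIcc).deriv]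
    have hw := h.weak φ h1 h2 h3
    have e : ∫ x in Ioo l r, (v x - ∫ t in l..x, g t) * deriv φ x
        = (∫ x in Ioo l r, v x * deriv φ x)
          - ∫ x in Ioo l r, (∫ t in l..x, g t) * deriv φ x := by
      rw [← integral_sub]
      · congr 1
        ext x
        ring
      · exact ((h.cont.mul hφ.continuousOn).integrableOn_Icc).mono_set Ioo_subset_Icc_self
      · exact ((hGc.mul hφ.continuousOn).integrableOn_Icc).mono_set Ioo_subset_Icc_self
    change ∫ x in Ioo l r, (v x - ∫ t in l..x, g t) * deriv φ x = 0
    rw [e, hw, setIntegral_Ioo_eq hlr.le, setIntegral_Ioo_eq hlr.le, hparts, hder]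
    ring)
  have hsub : ∀ z ∈ Icc l r, IntervalIntegrable g volume l z := fun z hz =>
    hg.mono_set (by rw [uIcc_of_le hlr.le, uIcc_of_le hz.1]; exact Icc_subset_Icc_right hz.2)
  have h1 := hc x hx
  have h2 := hc y hy
  have h3 := intervalIntegral.integral_interval_sub_left (hsub y hy) (hsub x hx)
  simp only [Pi.sub_apply] at h1 h2
  linarith

/-- A continuously differentiable function lies in `H¹`. -/
theorem isH1_of_hasDerivAt {l r : ℝ} (hlr : l < r) {v g : ℝ → ℝ} (hv : ∀ x, HasDerivAt v (g x) x)
    (hg : Continuous g) : IsH1 l r v g := by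
  have hvc : Continuous v := continuous_iff_continuousAt.2 fun x => (hv x).continuousAt
  refine ⟨hvc.continuousOn, inL2_of_continuousOn hvc.continuousOn,
    inL2_of_continuousOn hg.continuousOn, fun φ h1 h2 h3 => ?_⟩
  have hφ : Continuous (deriv φ) := h1.continuous_deriv (by simp)
  have := intervalIntegral.integral_mul_deriv_eq_deriv_mul (a := l) (b := r)
    (u := v) (v := φ) (fun x _ => hv x)
    (fun x _ => (h1.differentiable (by simp) x).hasDerivAt)
    (hg.intervalIntegrable _ _) (hφ.intervalIntegrable _ _)
  rw [setIntegral_Ioo_eq hlr.le, setIntegral_Ioo_eq hlr.le, this,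
    (eq_zero_of_tsupport_subset_Ioo h3).1, (eq_zero_of_tsupport_subset_Ioo h3).2]
  ring

/-! ### The Poincaré–Friedrichs inequality. -/

theorem sq_integral_abs_le {l r : ℝ} (hlr : l < r) {g : ℝ → ℝ} (hg : InL2 (Ioo l r) g) :
    (∫ x in Ioo l r, |g x|) ^ 2 ≤ (r - l) * ip (Ioo l r) g g := by
  set A := ∫ x in Ioo l r, |g x|
  have hi1 : IntegrableOn (fun x => |g x|) (Ioo l r) := hg.integrableOn.abs
  have hi2 : IntegrableOn (fun x => g x * g x) (Ioo l r) := hg.integrable_mul hg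
  have hpos : 0 < r - l := sub_pos.2 hlr
  -- Cauchy–Schwarz against the constant 1: the square expands to `(r - l) ((r - l) (g, g) - A²)`.
  have hmain : 0 ≤ ∫ x in Ioo l r, ((r - l) * |g x| - A) ^ 2 :=
    integral_nonneg fun x => sq_nonneg _
  have hexp : ∫ x in Ioo l r, ((r - l) * |g x| - A) ^ 2
      = (r - l) ^ 2 * ip (Ioo l r) g g - 2 * (r - l) * A * A + (r - l) * A ^ 2 := by
    have : ∀ x, ((r - l) * |g x| - A) ^ 2
        = (r - l) ^ 2 * (g x * g x) - 2 * (r - l) * A * |g x| + A ^ 2 := fun x => by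
      have := abs_mul_abs_self (g x)
      linear_combination (r - l) ^ 2 * this
    simp only [this]
    rw [integral_add, integral_sub, integral_const_mul, integral_const_mul, setIntegral_const,
      Real.volume_real_Ioo_of_le hlr.le]
    · rfl
    · exact hi2.const_mul _
    · exact hi1.const_mul _
    · exact (hi2.const_mul _).sub (hi1.const_mul _)
    · exact integrableOn_const (by simp)
  rw [hexp] at hmain
  have : 0 ≤ (r - l) * ((r - l) * ip (Ioo l r) g g - A ^ 2) := by linarith
  linarith [nonneg_of_mul_nonneg_right this hpos]

/-- The Poincaré–Friedrichs inequality for functions with a zero. -/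
theorem IsH1.nrm_le_of_exists_eq_zero {l r : ℝ} (hlr : l < r) {v g : ℝ → ℝ} (h : IsH1 l r v g)
    (h0 : ∃ y ∈ Icc l r, v y = 0) : nrm (Ioo l r) v ≤ (r - l) * nrm (Ioo l r) g := by
  obtain ⟨y, hy, hy0⟩ := h0
  have hpos : 0 < r - l := sub_pos.2 hlr
  have hgabs : IntegrableOn (fun x => |g x|) (Ioo l r) := h.grad_memL2.integrableOn.abs
  have hpt : ∀ x ∈ Icc l r, |v x| ≤ ∫ t in Ioo l r, |g t| := fun x hx => by
    have h1 := h.integral_eq_sub hlr hy hx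
    rw [hy0, sub_zero] at h1
    rw [← h1, ← integral_Ioc_eq_integral_Ioo]
    refine (intervalIntegral.norm_integral_le_integral_norm_uIoc (f := g)).trans ?_
    refine setIntegral_mono_set ?_ (Filter.Eventually.of_forall fun t => norm_nonneg _) ?_
    · rw [integrableOn_Ioc_iff_integrableOn_Ioo]
      exact hgabs
    · exact (Ioc_subset_Ioc (le_min hy.1 hx.1) (max_le hy.2 hx.2)).eventuallyLE
  have hsq : ip (Ioo l r) v v ≤ (r - l) * (∫ t in Ioo l r, |g t|) ^ 2 := by
    have : ip (Ioo l r) v v ≤ ∫ x in Ioo l r, (∫ t in Ioo l r, |g t|) ^ 2 := by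
      refine setIntegral_mono_on (h.memL2.integrable_mul h.memL2)
        (integrableOn_const (by simp)) measurableSet_Ioo fun x hx => ?_
      have := hpt x (Ioo_subset_Icc_self hx)
      rw [← abs_mul_abs_self, sq]
      exact mul_self_le_mul_self (abs_nonneg _) this
    rwa [setIntegral_const, Real.volume_real_Ioo_of_le hlr.le, smul_eq_mul] at this
  have hip : ip (Ioo l r) v v ≤ (r - l) ^ 2 * ip (Ioo l r) g g := by
    have := mul_le_mul_of_nonneg_left (sq_integral_abs_le hlr h.grad_memL2) hpos.le
    linarith
  rw [nrm, nrm]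
  refine (Real.sqrt_le_sqrt hip).trans ?_
  rw [Real.sqrt_mul (sq_nonneg _), Real.sqrt_sq hpos.le]

/-- A continuous function without zeros has constant sign, hence nonzero integral. This reduces the
mean-zero case of Poincaré–Friedrichs to that of a function with a zero. -/
theorem exists_eq_zero_of_integral_eq_zero {l r : ℝ} (hlr : l < r) {v : ℝ → ℝ}
    (hv : ContinuousOn v (Icc l r)) (h : ∫ x in Ioo l r, v x = 0) :
    ∃ y ∈ Icc l r, v y = 0 := by
  by_contra hne
  push Not at hne
  have hpos : ∀ w : ℝ → ℝ, ContinuousOn w (Icc l r) → (∫ x in Ioo l r, w x = 0) →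
      ¬ ∀ x ∈ Icc l r, 0 < w x := fun w hw h0 hw0 => by
    have := intervalIntegral.intervalIntegral_pos_of_pos_on (f := w) (a := l) (b := r)
      (by exact ContinuousOn.intervalIntegrable_of_Icc hlr.le hw)
      (fun x hx => hw0 x (Ioo_subset_Icc_self hx)) hlr
    rw [setIntegral_Ioo_eq hlr.le] at h0
    linarith
  have hl : l ∈ Icc l r := left_mem_Icc.2 hlr.le
  have hsign : ∀ w : ℝ → ℝ, ContinuousOn w (Icc l r) → (∀ x ∈ Icc l r, w x ≠ 0) → 0 < w l →
      ∀ x ∈ Icc l r, 0 < w x := fun w hw hw0 hwl x hx => by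
    by_contra hx'
    obtain ⟨z, hz, hz0⟩ := isPreconnected_Icc.intermediate_value hx hl hw
      ⟨not_lt.1 hx', hwl.le⟩
    exact hw0 z hz hz0
  rcases lt_or_gt_of_ne (hne l hl) with h1 | h1
  · refine hpos (fun x => -v x) hv.neg (by rw [integral_neg, h, neg_zero]) ?_
    exact hsign _ hv.neg (fun x hx => neg_ne_zero.2 (hne x hx)) (neg_pos.2 h1)
  · exact hpos v hv h (hsign v hv hne h1)

/-! ### Mesh geometry and hat functions. -/

namespace Mesh

variable {l r : ℝ} (T : Mesh l r)

theorem n_pos (hlr : l < r) : 0 < T.n := by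
  rcases Nat.eq_zero_or_pos T.n with h | h
  · have : (0 : Fin (T.n + 1)) = Fin.last T.n := Fin.ext (by simp [h])
    have h1 := T.first
    rw [this, T.last] at h1
    exact absurd h1 hlr.ne'
  · exact h

theorem node_lt (i : Fin T.n) : T.node i.castSucc < T.node i.succ :=
  T.strictMono Fin.castSucc_lt_succ

theorem node_le {a c : Fin (T.n + 1)} (h : a.val ≤ c.val) : T.node a ≤ T.node c :=
  T.strictMono.monotone h

theorem left_le_node (a : Fin (T.n + 1)) : l ≤ T.node a :=
  T.first.ge.trans (T.node_le (Nat.zero_le _))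

theorem node_le_right (a : Fin (T.n + 1)) : T.node a ≤ r :=
  (T.node_le (Nat.lt_succ_iff.1 a.2)).trans_eq T.last

theorem exists_mem_closedElem (hlr : l < r) {x : ℝ} (hx : x ∈ Icc l r) :
    ∃ i : Fin T.n, x ∈ Icc (T.node i.castSucc) (T.node i.succ) := by
  by_contra! h
  have hle : ∀ j : Fin (T.n + 1), T.node j ≤ x := by
    intro j
    induction j using Fin.induction with
    | zero => rw [T.first]; exact hx.1
    | succ i ih =>
      by_contra hlt
      exact h i ⟨ih, (not_le.1 hlt).le⟩
  have hn := T.n_pos hlr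
  let i : Fin T.n := ⟨T.n - 1, by omega⟩
  have hi : i.succ = Fin.last T.n := Fin.ext (by simp [i]; omega)
  exact h i ⟨hle _, by rw [hi, T.last]; exact hx.2⟩

theorem mem_elem_or_mem_range {x : ℝ} {i : Fin T.n}
    (hx : x ∈ Icc (T.node i.castSucc) (T.node i.succ)) : x ∈ T.elem i ∨ x ∈ range T.node := by
  rcases hx.1.eq_or_lt with h | h
  · exact Or.inr ⟨_, h⟩
  · rcases hx.2.eq_or_lt with h' | h'
    · exact Or.inr ⟨_, h'.symm⟩
    · exact Or.inl ⟨h, h'⟩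

theorem ae_notMem_range_node : ∀ᵐ x : ℝ, x ∉ range T.node :=
  (finite_range T.node).countable.ae_notMem volume

theorem elem_subset (i : Fin T.n) : T.elem i ⊆ Ioo l r :=
  Ioo_subset_Ioo (T.left_le_node _) (T.node_le_right _)

/-- The elements cover the interval up to the finitely many vertices, a null set. -/
theorem ae_iff_forall_elem (hlr : l < r) {P : ℝ → Prop} :
    (∀ᵐ x ∂volume.restrict (Ioo l r), P x) ↔
      ∀ i, ∀ᵐ x ∂volume.restrict (T.elem i), P x := by
  refine ⟨fun h i => ae_restrict_of_ae_restrict_of_subset (T.elem_subset i) h, fun h => ?_⟩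
  rw [ae_restrict_iff' measurableSet_Ioo]
  have h' : ∀ᵐ x : ℝ, ∀ i, x ∈ T.elem i → P x :=
    ae_all_iff.2 fun i => (ae_restrict_iff' measurableSet_Ioo).1 (h i)
  filter_upwards [h', T.ae_notMem_range_node] with x hx hx' hxm
  obtain ⟨i, hi⟩ := T.exists_mem_closedElem hlr (Ioo_subset_Icc_self hxm)
  exact hx i ((T.mem_elem_or_mem_range hi).resolve_right hx')

theorem patchLeft_le (a : Fin (T.n + 1)) : T.patchLeft a ≤ T.node a :=
  T.node_le (Nat.sub_le _ _)

theorem le_patchRight (a : Fin (T.n + 1)) : T.node a ≤ T.patchRight a :=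
  T.node_le (by have := a.2; simp only [le_min_iff]; omega)

theorem patchRight_castSucc (i : Fin T.n) : T.patchRight i.castSucc = T.node i.succ := by
  rw [patchRight]
  congr 1
  ext
  simp

theorem patchLeft_succ (i : Fin T.n) : T.patchLeft i.succ = T.node i.castSucc := by
  rw [patchLeft]
  congr 1

theorem patchLeft_lt_patchRight (hlr : l < r) (a : Fin (T.n + 1)) :
    T.patchLeft a < T.patchRight a := by
  have := T.n_pos hlr
  refine T.strictMono ?_
  rw [Fin.mk_lt_mk]
  omega

theorem closedElem_subset {a : Fin (T.n + 1)} {i : Fin T.n} (hi : i ∈ T.patchElems a) :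
    Icc (T.node i.castSucc) (T.node i.succ) ⊆ Icc (T.patchLeft a) (T.patchRight a) := by
  rcases hi with rfl | rfl
  · rw [patchRight_castSucc]
    exact Icc_subset_Icc_left (T.patchLeft_le _)
  · rw [patchLeft_succ]
    exact Icc_subset_Icc_right (T.le_patchRight _)

theorem elem_subset_patch {a : Fin (T.n + 1)} {i : Fin T.n} (hi : i ∈ T.patchElems a) :
    T.elem i ⊆ T.patch a := by
  rcases hi with rfl | rfl
  · rw [patch, patchRight_castSucc]
    exact Ioo_subset_Ioo_left (T.patchLeft_le _)
  · rw [patch, patchLeft_succ]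
    exact Ioo_subset_Ioo_right (T.le_patchRight _)

theorem patch_subset (a : Fin (T.n + 1)) : T.patch a ⊆ Ioo l r :=
  Ioo_subset_Ioo (T.left_le_node _) (T.node_le_right _)

/-- The strict inequalities say that the patch really extends beyond `a` on the side of the element.
At an end vertex `a` is itself an end of its patch, and there the hat is 1 instead of 0. -/
theorem le_patchLeft_or_patchRight_le {a : Fin (T.n + 1)} {i : Fin T.n}
    (hi : i ∉ T.patchElems a) :
    (T.node i.succ ≤ T.patchLeft a ∧ T.patchLeft a < T.node a) ∨
      (T.patchRight a ≤ T.node i.castSucc ∧ T.node a < T.patchRight a) := by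
  have h1 : i.val ≠ a.val := fun h => hi (Or.inl (Fin.ext h))
  have h2 : i.val + 1 ≠ a.val := fun h => hi (Or.inr (Fin.ext h))
  have hin := i.2
  rcases Nat.lt_or_ge i.val a.val with h | h
  · refine Or.inl ⟨T.node_le ?_, T.strictMono ?_⟩
    · simp only [Fin.val_succ]; omega
    · rw [Fin.lt_def]; simp only; omega
  · refine Or.inr ⟨T.node_le ?_, T.strictMono ?_⟩
    · simp only [Fin.val_castSucc]; omega
    · rw [Fin.lt_def]; simp only; omega

theorem mem_patchElems_of_mem_patch {a : Fin (T.n + 1)} {i : Fin T.n} {x : ℝ}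
    (hx : x ∈ T.patch a) (hi : x ∈ T.elem i) : i ∈ T.patchElems a := by
  by_contra h
  rcases T.le_patchLeft_or_patchRight_le h with h' | h'
  · exact absurd (hi.2.trans_le h'.1) (not_lt.2 hx.1.le)
  · exact absurd (h'.1.trans_lt hi.1) (not_lt.2 hx.2.le)

theorem hat_castSucc (i : Fin T.n) {x : ℝ} (hx : x ∈ Icc (T.node i.castSucc) (T.node i.succ)) :
    T.hat i.castSucc x = (T.node i.succ - x) / (T.node i.succ - T.node i.castSucc) := by
  have h1 := T.patchLeft_le i.castSucc
  have h2 := T.node_lt i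
  rw [hat, patchRight_castSucc, if_neg (by rintro (h | h) <;> linarith [hx.1, hx.2]),
    if_neg (not_lt.2 hx.1)]
  split_ifs with h
  · rfl
  · rw [le_antisymm (not_lt.1 h) hx.1, div_self (sub_pos.2 h2).ne']

theorem hat_succ (i : Fin T.n) {x : ℝ} (hx : x ∈ Icc (T.node i.castSucc) (T.node i.succ)) :
    T.hat i.succ x = (x - T.node i.castSucc) / (T.node i.succ - T.node i.castSucc) := by
  have h1 := T.le_patchRight i.succ
  have h2 := T.node_lt i
  rw [hat, patchLeft_succ, if_neg (by rintro (h | h) <;> linarith [hx.1, hx.2])]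
  split_ifs with h h'
  · rfl
  · exact absurd h' (not_lt.2 hx.2)
  · rw [le_antisymm hx.2 (not_lt.1 h), div_self (sub_pos.2 h2).ne']

theorem hat_eq_zero_of_notMem {a : Fin (T.n + 1)} {i : Fin T.n} (hi : i ∉ T.patchElems a) {x : ℝ}
    (hx : x ∈ Icc (T.node i.castSucc) (T.node i.succ)) : T.hat a x = 0 := by
  rw [hat]
  split_ifs with h1 h2 h3
  · rfl
  · push Not at h1
    rcases T.le_patchLeft_or_patchRight_le hi with h | h
    · rw [le_antisymm (hx.2.trans h.1) h1.1, sub_self, zero_div]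
    · linarith [hx.1]
  · push Not at h1
    rcases T.le_patchLeft_or_patchRight_le hi with h | h
    · linarith [hx.2]
    · rw [le_antisymm h1.2 (h.1.trans hx.1), sub_self, zero_div]
  · rcases T.le_patchLeft_or_patchRight_le hi with h | h
    · linarith [hx.2]
    · linarith [hx.1]

/-- The hat functions are affine on the closed elements. -/
theorem exists_hat_eq_affine (a : Fin (T.n + 1)) (i : Fin T.n) :
    ∃ α β : ℝ, ∀ x ∈ Icc (T.node i.castSucc) (T.node i.succ), T.hat a x = α + β * x := by
  by_cases hi : i ∈ T.patchElems a
  · rcases hi with rfl | rfl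
    · exact ⟨T.node i.succ / (T.node i.succ - T.node i.castSucc),
        -1 / (T.node i.succ - T.node i.castSucc), fun x hx => by rw [T.hat_castSucc i hx]; ring⟩
    · exact ⟨-T.node i.castSucc / (T.node i.succ - T.node i.castSucc),
        1 / (T.node i.succ - T.node i.castSucc), fun x hx => by rw [T.hat_succ i hx]; ring⟩
  · exact ⟨0, 0, fun x hx => by rw [T.hat_eq_zero_of_notMem hi hx]; ring⟩

theorem hat_left {a : Fin (T.n + 1)} (hlr : l < r) (ha : a.val ≠ 0) : T.hat a l = 0 := by
  have hn := T.n_pos hlr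
  let i : Fin T.n := ⟨0, hn⟩
  have hi : i.castSucc = 0 := rfl
  have hx : l ∈ Icc (T.node i.castSucc) (T.node i.succ) := by
    rw [hi, T.first]
    exact ⟨le_rfl, T.left_le_node _⟩
  by_cases h : i ∈ T.patchElems a
  · rcases h with rfl | rfl
    · exact absurd rfl ha
    · rw [T.hat_succ i hx, hi, T.first, sub_self, zero_div]
  · exact T.hat_eq_zero_of_notMem h hx

theorem hat_right {a : Fin (T.n + 1)} (hlr : l < r) (ha : a.val ≠ T.n) : T.hat a r = 0 := by
  have hn := T.n_pos hlr
  let i : Fin T.n := ⟨T.n - 1, by omega⟩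
  have hi : i.succ = Fin.last T.n := Fin.ext (by simp [i]; omega)
  have hx : r ∈ Icc (T.node i.castSucc) (T.node i.succ) := by
    rw [hi, T.last]
    exact ⟨T.node_le_right _, le_rfl⟩
  by_cases h : i ∈ T.patchElems a
  · rcases h with rfl | rfl
    · rw [T.hat_castSucc i hx, hi, T.last, sub_self, zero_div]
    · exact absurd (congrArg Fin.val hi) ha
  · exact T.hat_eq_zero_of_notMem h hx

/-- The hat functions form a partition of unity. -/
theorem sum_hat (i : Fin T.n) {x : ℝ} (hx : x ∈ Icc (T.node i.castSucc) (T.node i.succ)) :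
    ∑ a, T.hat a x = 1 := by
  have h := (sub_pos.2 (T.node_lt i)).ne'
  rw [Finset.sum_eq_add i.castSucc i.succ Fin.castSucc_lt_succ.ne, T.hat_castSucc i hx,
    T.hat_succ i hx]
  · field_simp
    ring
  · intro a _ ha
    refine T.hat_eq_zero_of_notMem ?_ hx
    rintro (rfl | rfl)
    · exact ha.1 rfl
    · exact ha.2 rfl
  · simp
  · simp

theorem elem_mem_nhds {i : Fin T.n} {x : ℝ} (hx : x ∈ T.elem i) : T.elem i ∈ nhds x :=
  isOpen_Ioo.mem_nhds hx

theorem differentiableAt_hat (a : Fin (T.n + 1)) {i : Fin T.n} {x : ℝ} (hx : x ∈ T.elem i) :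
    DifferentiableAt ℝ (T.hat a) x := by
  obtain ⟨α, β, h⟩ := T.exists_hat_eq_affine a i
  have : T.hat a =ᶠ[nhds x] fun y => α + β * y :=
    Filter.eventuallyEq_of_mem (T.elem_mem_nhds hx) fun y hy => h y (Ioo_subset_Icc_self hy)
  exact this.differentiableAt_iff.2 (by fun_prop)

theorem sum_deriv_hat {i : Fin T.n} {x : ℝ} (hx : x ∈ T.elem i) :
    ∑ a, deriv (T.hat a) x = 0 := by
  rw [← deriv_fun_sum fun a _ => T.differentiableAt_hat a hx]
  have : (fun y => ∑ a, T.hat a y) =ᶠ[nhds x] fun _ => 1 :=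
    Filter.eventuallyEq_of_mem (T.elem_mem_nhds hx) fun y hy =>
      T.sum_hat i (Ioo_subset_Icc_self hy)
  rw [this.deriv_eq, deriv_const]

theorem continuousOn_of_forall_closedElem (hlr : l < r) {F : ℝ → ℝ}
    (h : ∀ i : Fin T.n, ContinuousOn F (Icc (T.node i.castSucc) (T.node i.succ))) :
    ContinuousOn F (Icc l r) :=
  ((locallyFinite_of_finite _).continuousOn_iUnion (fun _ => isClosed_Icc) h).mono fun _ hx =>
    mem_iUnion.2 (T.exists_mem_closedElem hlr hx)

/-! ### Piecewise polynomials. -/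

theorem IsPiecewisePoly.inL2 {I : Set (Fin T.n)} {m : ℕ} {v : ℝ → ℝ}
    (hv : T.IsPiecewisePoly I m v) (hlr : l < r) {D : Set ℝ} (hD : D ⊆ Ioo l r)
    (hI : ∀ i, ∀ x ∈ D, x ∈ T.elem i → i ∈ I) : InL2 D v := by
  have hL2 : ∀ i ∈ I, InL2 (T.elem i) v := fun i hi => by
    obtain ⟨p, -, hp⟩ := hv i hi
    exact (memLp_congr_ae hp).2 (inL2_of_continuousOn p.continuous.continuousOn)
  -- By `hI`, every element that meets `D` has its index in `I`; only vertices are missed.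
  have hsub : D ≤ᵐ[volume] ⋃ i : I, T.elem i := by
    filter_upwards [T.ae_notMem_range_node] with x hx hxD
    obtain ⟨i, hi⟩ := T.exists_mem_closedElem hlr (Ioo_subset_Icc_self (hD hxD))
    have hi' := (T.mem_elem_or_mem_range hi).resolve_right hx
    exact mem_iUnion.2 ⟨⟨i, hI i x hxD hi'⟩, hi'⟩
  have hU : MemLp v 2 (volume.restrict (⋃ i : I, T.elem i)) := by
    rw [memLp_two_iff_integrable_sq]
    · exact integrableOn_finite_iUnion.2 fun i => (hL2 i i.2).integrable_sq
    · exact AEStronglyMeasurable.iUnion fun i => (hL2 i i.2).aestronglyMeasurable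
  exact hU.mono_measure (Measure.restrict_mono' hsub le_rfl)

theorem InYh.inL2_patch {a : Fin (T.n + 1)} {m : ℕ} {v : ℝ → ℝ} (hv : T.InYh m a v)
    (hlr : l < r) : InL2 (T.patch a) v :=
  IsPiecewisePoly.inL2 T hv hlr (T.patch_subset a) fun _ _ => T.mem_patchElems_of_mem_patch

theorem InPh.inL2 {m : ℕ} {v : ℝ → ℝ} (hv : T.InPh m v) (hlr : l < r) : InL2 (Ioo l r) v :=
  IsPiecewisePoly.inL2 T hv hlr Subset.rfl fun i _ _ _ => mem_univ i

theorem IsPiecewisePoly.sub {I : Set (Fin T.n)} {m : ℕ} {v w : ℝ → ℝ}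
    (hv : T.IsPiecewisePoly I m v) (hw : T.IsPiecewisePoly I m w) :
    T.IsPiecewisePoly I m (fun x => v x - w x) := fun i hi => by
  obtain ⟨p, hp, hp'⟩ := hv i hi
  obtain ⟨q, hq, hq'⟩ := hw i hi
  refine ⟨p - q, Polynomial.natDegree_sub_le_of_le hp hq |>.trans (by simp), ?_⟩
  filter_upwards [hp', hq'] with x h1 h2
  rw [h1, h2, Polynomial.eval_sub]

end Mesh

/-! ### The products `ψ_a s` and the local problems. -/

namespace Mesh

variable {l r : ℝ} (T : Mesh l r)

/-- Continuity of `s` upgrades its almost-everywhere polynomial form to equality on the whole open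
element, so that classical derivatives make sense. Off the patch nothing is known about `s`, but
`ψ_a` vanishes. -/
theorem exists_eval_eq_hat_mul {m : ℕ} {a : Fin (T.n + 1)} {s : ℝ → ℝ} (hs : T.InXh m a s)
    (i : Fin T.n) : ∃ Q : Polynomial ℝ, Q.natDegree ≤ m + 1 ∧
      ∀ x ∈ T.elem i, T.hat a x * s x = Q.eval x := by
  by_cases hi : i ∈ T.patchElems a
  · obtain ⟨p, hp, hpe⟩ := hs.1 i hi
    obtain ⟨g, hg⟩ := hs.2
    have hsc : ContinuousOn s (T.elem i) :=
      hg.cont.mono (Ioo_subset_Icc_self.trans (T.closedElem_subset hi))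
    have heq := Measure.eqOn_open_of_ae_eq hpe isOpen_Ioo hsc p.continuous.continuousOn
    obtain ⟨α, β, h⟩ := T.exists_hat_eq_affine a i
    refine ⟨(Polynomial.C β * Polynomial.X + Polynomial.C α) * p, ?_, fun x hx => ?_⟩
    · exact (Polynomial.natDegree_mul_le_of_le Polynomial.natDegree_linear_le hp).trans
        (add_comm 1 m).le
    · rw [h x (Ioo_subset_Icc_self hx), heq hx]
      simp only [Polynomial.eval_mul, Polynomial.eval_add, Polynomial.eval_C, Polynomial.eval_X]
      ring
  · refine ⟨0, by simp, fun x hx => ?_⟩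
    rw [T.hat_eq_zero_of_notMem hi (Ioo_subset_Icc_self hx), zero_mul, Polynomial.eval_zero]

/-- Multiplication by `ψ_a` raises the degree by one and differentiation lowers it again, so the
left side of the local problem lies in the test space. -/
theorem exists_hasDerivAt_hat_mul {m : ℕ} {a : Fin (T.n + 1)} {s : ℝ → ℝ} (hs : T.InXh m a s)
    (i : Fin T.n) : ∃ Q : Polynomial ℝ, Q.natDegree ≤ m ∧
      ∀ x ∈ T.elem i, HasDerivAt (fun y => T.hat a y * s y) (Q.eval x) x := by
  obtain ⟨Q, hQ, hQe⟩ := T.exists_eval_eq_hat_mul hs i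
  refine ⟨Q.derivative, (Polynomial.natDegree_derivative_le Q).trans (by omega), fun x hx => ?_⟩
  exact (Q.hasDerivAt x).congr_of_eventuallyEq
    (Filter.eventuallyEq_of_mem (T.elem_mem_nhds hx) hQe)

theorem inPh_deriv_hat_mul {m : ℕ} {a : Fin (T.n + 1)} {s : ℝ → ℝ} (hs : T.InXh m a s) :
    T.InPh m (deriv fun y => T.hat a y * s y) := fun i _ => by
  obtain ⟨Q, hQ, hQe⟩ := T.exists_hasDerivAt_hat_mul hs i
  exact ⟨Q, hQ, (ae_restrict_iff' measurableSet_Ioo).2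
    (Filter.Eventually.of_forall fun x hx => (hQe x hx).deriv)⟩

theorem continuousOn_hat_mul (hlr : l < r) {m : ℕ} {a : Fin (T.n + 1)} {s : ℝ → ℝ}
    (hs : T.InXh m a s) : ContinuousOn (fun y => T.hat a y * s y) (Icc l r) := by
  refine T.continuousOn_of_forall_closedElem hlr fun i => ?_
  by_cases hi : i ∈ T.patchElems a
  · obtain ⟨g, hg⟩ := hs.2
    obtain ⟨α, β, h⟩ := T.exists_hat_eq_affine a i
    refine ContinuousOn.mul ?_ (hg.cont.mono (T.closedElem_subset hi))
    exact ContinuousOn.congr (f := fun y => α + β * y) (by fun_prop) h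
  · refine ContinuousOn.congr (f := fun _ => 0) continuousOn_const fun x hx => ?_
    rw [T.hat_eq_zero_of_notMem hi hx, zero_mul]

theorem exists_deriv_hat_eq (a : Fin (T.n + 1)) (i : Fin T.n) :
    ∃ β : ℝ, ∀ x ∈ T.elem i, deriv (T.hat a) x = β := by
  obtain ⟨α, β, h⟩ := T.exists_hat_eq_affine a i
  refine ⟨β, fun x hx => ?_⟩
  have : T.hat a =ᶠ[nhds x] fun y => α + β * y :=
    Filter.eventuallyEq_of_mem (T.elem_mem_nhds hx) fun y hy => h y (Ioo_subset_Icc_self hy)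
  rw [this.deriv_eq]
  simp

theorem deriv_eq_zero_of_notMem {a : Fin (T.n + 1)} {i : Fin T.n} (hi : i ∉ T.patchElems a)
    {x : ℝ} (hx : x ∈ T.elem i) (w : ℝ → ℝ) : deriv (fun y => T.hat a y * w y) x = 0 := by
  have : (fun y => T.hat a y * w y) =ᶠ[nhds x] fun _ => 0 :=
    Filter.eventuallyEq_of_mem (T.elem_mem_nhds hx) fun y hy => by
      simp only [T.hat_eq_zero_of_notMem hi (Ioo_subset_Icc_self hy), zero_mul]
  rw [this.deriv_eq, deriv_const]

theorem deriv_hat_eq_zero_of_notMem {a : Fin (T.n + 1)} {i : Fin T.n} (hi : i ∉ T.patchElems a)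
    {x : ℝ} (hx : x ∈ T.elem i) : deriv (T.hat a) x = 0 := by
  simpa using T.deriv_eq_zero_of_notMem hi hx fun _ => 1

theorem InPh.inYh {m : ℕ} {v : ℝ → ℝ} (hv : T.InPh m v) (a : Fin (T.n + 1)) : T.InYh m a v :=
  fun i _ => hv i (mem_univ i)

/-- The local problem is solved exactly if `ψ_a f` is a piecewise polynomial. -/
theorem IsLocalSolution.ae_eq (hlr : l < r) {b : ℝ} {f uh : ℝ → ℝ} {k k' : ℕ} (hk : k ≤ k')
    (huh : T.InPh k uh) {a : Fin (T.n + 1)} {s : ℝ → ℝ} (hs : T.IsLocalSolution b f uh k' a s)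
    (hψf : T.InYh k' a (fun x => T.hat a x * f x)) :
    ∀ᵐ x ∂volume.restrict (Ioo l r),
      b * deriv (fun y => T.hat a y * s y) x
        = f x * T.hat a x + b * deriv (T.hat a) x * uh x := by
  obtain ⟨hX, hsol⟩ := hs
  set L : ℝ → ℝ := fun x => b * deriv (fun y => T.hat a y * s y) x with hLdef
  set R : ℝ → ℝ := fun x => f x * T.hat a x + b * deriv (T.hat a) x * uh x with hRdef
  have hL : T.InYh k' a L := fun i hi => by
    obtain ⟨Q, hQ, hQe⟩ := InPh.inYh T (T.inPh_deriv_hat_mul hX) a i hi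
    refine ⟨Polynomial.C b * Q, (Polynomial.natDegree_C_mul_le b Q).trans hQ, ?_⟩
    filter_upwards [hQe] with x hx
    rw [hLdef, Polynomial.eval_mul, Polynomial.eval_C, ← hx]
  have hR : T.InYh k' a R := fun i hi => by
    obtain ⟨p, hp, hpe⟩ := hψf i hi
    obtain ⟨q, hq, hqe⟩ := InPh.inYh T huh a i hi
    obtain ⟨β, hβ⟩ := T.exists_deriv_hat_eq a i
    refine ⟨p + Polynomial.C (b * β) * q, Polynomial.natDegree_add_le_of_degree_le hp
      ((Polynomial.natDegree_C_mul_le _ q).trans (hq.trans hk)), ?_⟩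
    filter_upwards [hpe, hqe, ae_restrict_mem measurableSet_Ioo] with x h1 h2 h3
    simp only [hRdef, Polynomial.eval_add, Polynomial.eval_mul, Polynomial.eval_C]
    rw [← h1, ← h2, hβ x h3]
    ring
  -- Both sides have degree at most `k'`, the right one by `hψf` and `k ≤ k'`; hence the residual is
  -- itself an admissible test function and has zero norm.
  have hd : T.InYh k' a (fun x => L x - R x) := IsPiecewisePoly.sub T hL hR
  have hL2 := InYh.inL2_patch T hL hlr
  have hR2 := InYh.inL2_patch T hR hlr
  have hd2 := InYh.inL2_patch T hd hlr
  have hzero : ∫ x in T.patch a, (L x - R x) * (L x - R x) = 0 := by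
    have h1 : ∫ x in T.patch a, (L x - R x) * (L x - R x)
        = ip (T.patch a) L (fun x => L x - R x) - ip (T.patch a) R (fun x => L x - R x) := by
      rw [ip, ip, ← integral_sub (f := fun x => L x * (L x - R x))
        (g := fun x => R x * (L x - R x)) (hL2.integrable_mul hd2) (hR2.integrable_mul hd2)]
      congr 1
      ext x
      ring
    rw [h1, hsol _ hd, sub_self]
  have hae : ∀ᵐ x ∂volume.restrict (T.patch a), L x = R x := by
    have := (integral_eq_zero_iff_of_nonneg (fun x => mul_self_nonneg (L x - R x))
      (hd2.integrable_mul hd2)).1 hzero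
    filter_upwards [this] with x hx
    exact sub_eq_zero.1 (mul_self_eq_zero.1 hx)
  refine (T.ae_iff_forall_elem hlr).2 fun i => ?_
  by_cases hi : i ∈ T.patchElems a
  · exact ae_restrict_of_ae_restrict_of_subset (T.elem_subset_patch hi) hae
  · filter_upwards [ae_restrict_mem measurableSet_Ioo] with x hx
    rw [T.deriv_eq_zero_of_notMem hi hx, T.deriv_hat_eq_zero_of_notMem hi hx,
      T.hat_eq_zero_of_notMem hi (Ioo_subset_Icc_self hx)]
    ring

/-- Integration by parts for `ψ_a s` against a continuously differentiable function. -/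
theorem integral_deriv_hat_mul_add (hlr : l < r) {m : ℕ} {a : Fin (T.n + 1)} {s : ℝ → ℝ}
    (hs : T.InXh m a s) {v χ : ℝ → ℝ} (hv : ∀ x, HasDerivAt v (χ x) x) (hχ : Continuous χ) :
    (∫ x in Ioo l r, deriv (fun y => T.hat a y * s y) x * v x)
        + ∫ x in Ioo l r, T.hat a x * s x * χ x
      = T.hat a r * s r * v r - T.hat a l * s l * v l := by
  have hvc : Continuous v := continuous_iff_continuousAt.2 fun x => (hv x).continuousAt
  have hP := T.continuousOn_hat_mul hlr hs
  have hi1 : IntegrableOn (fun x => deriv (fun y => T.hat a y * s y) x * v x) (Ioo l r) :=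
    (InPh.inL2 T (T.inPh_deriv_hat_mul hs) hlr).integrable_mul
      (inL2_of_continuousOn hvc.continuousOn)
  have hi2 : IntegrableOn (fun x => T.hat a x * s x * χ x) (Ioo l r) :=
    (hP.mul hχ.continuousOn).integrableOn_Icc.mono_set Ioo_subset_Icc_self
  rw [← integral_add hi1 hi2, setIntegral_Ioo_eq hlr.le]
  -- The product is continuous across the vertices, so no jump terms arise there.
  refine integral_eq_of_hasDerivAt_off_countable_of_le (fun x => T.hat a x * s x * v x) _ hlr.le
    (finite_range T.node).countable (hP.mul hvc.continuousOn) ?_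
    (intervalIntegrable_of_Ioo hlr.le (hi1.add hi2))
  rintro x ⟨hx, hx'⟩
  obtain ⟨i, hi⟩ := T.exists_mem_closedElem hlr (Ioo_subset_Icc_self hx)
  obtain ⟨Q, -, hQ⟩ := T.exists_hasDerivAt_hat_mul hs i
  have hPx := hQ x ((T.mem_elem_or_mem_range hi).resolve_right hx')
  have := hPx.mul (hv x)
  rwa [← hPx.deriv] at this

theorem setIntegral_patch_eq (hlr : l < r) (a : Fin (T.n + 1)) (f uh : ℝ → ℝ) (b : ℝ) :
    ∫ x in T.patch a, (f x * T.hat a x + b * deriv (T.hat a) x * uh x)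
      = ∫ x in Ioo l r, (f x * T.hat a x + b * deriv (T.hat a) x * uh x) := by
  refine (setIntegral_eq_of_subset_of_ae_sdiff_eq_zero measurableSet_Ioo.nullMeasurableSet
    (T.patch_subset a) ?_).symm
  filter_upwards [T.ae_notMem_range_node] with x hx hxm
  obtain ⟨i, hi⟩ := T.exists_mem_closedElem hlr (Ioo_subset_Icc_self hxm.1)
  have hxi := (T.mem_elem_or_mem_range hi).resolve_right hx
  have hia : i ∉ T.patchElems a := fun h => hxm.2 (T.elem_subset_patch h hxi)
  rw [T.hat_eq_zero_of_notMem hia hi, T.deriv_hat_eq_zero_of_notMem hia hxi]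
  ring

end Mesh

/-! ### Boundary values, and exactness of the reconstruction. -/

namespace Mesh

variable {l r : ℝ} (T : Mesh l r)

theorem inPh_deriv_hat (a : Fin (T.n + 1)) : T.InPh 0 (deriv (T.hat a)) := fun i _ => by
  obtain ⟨β, hβ⟩ := T.exists_deriv_hat_eq a i
  refine ⟨Polynomial.C β, by simp, ?_⟩
  filter_upwards [ae_restrict_mem measurableSet_Ioo] with x hx
  rw [hβ x hx, Polynomial.eval_C]

theorem continuousOn_hat (hlr : l < r) (a : Fin (T.n + 1)) :
    ContinuousOn (T.hat a) (Icc l r) := by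
  refine T.continuousOn_of_forall_closedElem hlr fun i => ?_
  obtain ⟨α, β, h⟩ := T.exists_hat_eq_affine a i
  exact ContinuousOn.congr (f := fun y => α + β * y) (by fun_prop) h

theorem integrableOn_mul_hat (hlr : l < r) {f : ℝ → ℝ} (hf : InL2 (Ioo l r) f)
    (a : Fin (T.n + 1)) : IntegrableOn (fun x => f x * T.hat a x) (Ioo l r) :=
  hf.integrable_mul (inL2_of_continuousOn (T.continuousOn_hat hlr a))

theorem integrableOn_deriv_hat_mul (hlr : l < r) {k : ℕ} {uh : ℝ → ℝ} (huh : T.InPh k uh)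
    (b : ℝ) (a : Fin (T.n + 1)) :
    IntegrableOn (fun x => b * deriv (T.hat a) x * uh x) (Ioo l r) :=
  MemLp.integrable_mul ((InPh.inL2 T (T.inPh_deriv_hat a) hlr).const_mul b)
    (InPh.inL2 T huh hlr)

/-- Integrating the exact local equation, orthogonality makes the two end values of `ψ_a s` equal;
one of them is zero because `a` cannot be both end vertices. For the inflow vertex this yields the
inflow condition, which the trial space does not impose. -/
theorem hat_mul_eq_zero_of_notMem_outflow (hlr : l < r) {b : ℝ} (hb : b ≠ 0) {f uh : ℝ → ℝ}
    (hf : InL2 (Ioo l r) f) {k k' : ℕ} (hk : k ≤ k') (huh : T.InPh k uh)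
    (horth : T.HatOrthogonal b f uh) {a : Fin (T.n + 1)} {s : ℝ → ℝ}
    (hs : T.IsLocalSolution b f uh k' a s) (hψf : T.InYh k' a (fun x => T.hat a x * f x))
    (ha : T.node a ∉ outflow b l r) : T.hat a l * s l = 0 ∧ T.hat a r * s r = 0 := by
  have hparts := T.integral_deriv_hat_mul_add hlr hs.1 (v := fun _ => 1) (χ := fun _ => 0)
    (fun x => hasDerivAt_const x 1) continuous_const
  simp only [mul_one, mul_zero, integral_zero, add_zero] at hparts
  have hres : ∫ x in T.patch a, (f x * T.hat a x + b * deriv (T.hat a) x * uh x) = 0 := by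
    rw [integral_add ((T.integrableOn_mul_hat hlr hf a).mono_set (T.patch_subset a))
      ((T.integrableOn_deriv_hat_mul hlr huh b a).mono_set (T.patch_subset a)), ← horth a ha]
    simp only [ip, mul_comm]
  have hzero : b * ∫ x in Ioo l r, deriv (fun y => T.hat a y * s y) x = 0 := by
    rw [← integral_const_mul, integral_congr_ae (IsLocalSolution.ae_eq T hlr hk huh hs hψf),
      ← T.setIntegral_patch_eq hlr, hres]
  rw [(mul_eq_zero.1 hzero).resolve_left hb] at hparts
  have hn := T.n_pos hlr
  by_cases h0 : a.val = 0
  · have hr : T.hat a r * s r = 0 := by rw [T.hat_right hlr (by omega), zero_mul]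
    exact ⟨by linarith, hr⟩
  · have hl : T.hat a l * s l = 0 := by rw [T.hat_left hlr h0, zero_mul]
    exact ⟨hl, by linarith⟩

/-- The product of `ψ_a s` and a function that vanishes on the outflow boundary is zero at both end
points. -/
theorem hat_mul_mul_eq_zero (hlr : l < r) {b : ℝ} (hb : b ≠ 0) {f uh : ℝ → ℝ}
    (hf : InL2 (Ioo l r) f) {k k' : ℕ} (hk : k ≤ k') (huh : T.InPh k uh)
    (horth : T.HatOrthogonal b f uh) {a : Fin (T.n + 1)} {s : ℝ → ℝ}
    (hs : T.IsLocalSolution b f uh k' a s) (hψf : T.InYh k' a (fun x => T.hat a x * f x))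
    {v : ℝ → ℝ} (hv : ∀ x ∈ outflow b l r, v x = 0) :
    T.hat a l * s l * v l = 0 ∧ T.hat a r * s r * v r = 0 := by
  -- At the outflow vertex `v` vanishes at that end and `ψ_a` at the other; otherwise `ψ_a s`
  -- vanishes at both ends.
  by_cases ha : T.node a ∈ outflow b l r
  · rcases ha with ⟨h, hb'⟩ | ⟨h, hb'⟩
    · have hlast : a.val ≠ T.n := fun h' => by
        have : a = Fin.last T.n := Fin.ext h'
        rw [this, T.last] at h
        exact hlr.ne' h
      rw [T.hat_right hlr hlast, hv l (Or.inl ⟨rfl, hb'⟩)]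
      simp
    · have hfirst : a.val ≠ 0 := fun h' => by
        have : a = 0 := Fin.ext h'
        rw [this, T.first] at h
        exact hlr.ne h
      rw [T.hat_left hlr hfirst, hv r (Or.inr ⟨rfl, hb'⟩)]
      simp
  · obtain ⟨h1, h2⟩ :=
      T.hat_mul_eq_zero_of_notMem_outflow hlr hb hf hk huh horth hs hψf ha
    rw [h1, h2]
    simp

theorem continuousOn_reconstruction (hlr : l < r) {m : ℕ} {s : Fin (T.n + 1) → ℝ → ℝ}
    (hs : ∀ a, T.InXh m a (s a)) : ContinuousOn (T.reconstruction s) (Icc l r) :=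
  continuousOn_finsetSum _ fun a _ => T.continuousOn_hat_mul hlr (hs a)

/-- The reconstruction satisfies the ultra-weak equation for continuously differentiable test
functions. -/
theorem integral_reconstruction_mul (hlr : l < r) {b : ℝ} (hb : b ≠ 0) {f uh : ℝ → ℝ}
    (hf : InL2 (Ioo l r) f) {k k' : ℕ} (hk : k ≤ k') (huh : T.InPh k uh)
    (horth : T.HatOrthogonal b f uh) {s : Fin (T.n + 1) → ℝ → ℝ}
    (hs : ∀ a, T.IsLocalSolution b f uh k' a (s a))
    (hψf : ∀ a, T.InYh k' a (fun x => T.hat a x * f x)) {v χ : ℝ → ℝ}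
    (hder : ∀ x, HasDerivAt v (χ x) x) (hχ : Continuous χ)
    (hv : ∀ x ∈ outflow b l r, v x = 0) :
    b * ∫ x in Ioo l r, T.reconstruction s x * χ x = -∫ x in Ioo l r, f x * v x := by
  have hvc : Continuous v := continuous_iff_continuousAt.2 fun x => (hder x).continuousAt
  have hlocal : ∀ a, b * ∫ x in Ioo l r, T.hat a x * s a x * χ x
      = -∫ x in Ioo l r, (f x * T.hat a x + b * deriv (T.hat a) x * uh x) * v x := fun a => by
    have hparts := T.integral_deriv_hat_mul_add hlr (hs a).1 hder hχ
    obtain ⟨h1, h2⟩ := T.hat_mul_mul_eq_zero hlr hb hf hk huh horth (hs a) (hψf a) hv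
    have hcongr : b * ∫ x in Ioo l r, deriv (fun y => T.hat a y * s a y) x * v x
        = ∫ x in Ioo l r, (f x * T.hat a x + b * deriv (T.hat a) x * uh x) * v x := by
      rw [← integral_const_mul]
      refine integral_congr_ae ?_
      filter_upwards [IsLocalSolution.ae_eq T hlr hk huh (hs a) (hψf a)] with x hx
      rw [← hx]
      ring
    rw [← hcongr]
    linear_combination b * hparts - b * h1 + b * h2
  have hint1 : ∀ a ∈ Finset.univ, IntegrableOn (fun x => T.hat a x * s a x * χ x) (Ioo l r) :=
    fun a _ => ((T.continuousOn_hat_mul hlr (hs a).1).mul hχ.continuousOn).integrableOn_Icc.mono_set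
      Ioo_subset_Icc_self
  have hint2 : ∀ a ∈ Finset.univ, IntegrableOn
      (fun x => (f x * T.hat a x + b * deriv (T.hat a) x * uh x) * v x) (Ioo l r) := fun a _ => by
    have hi : IntervalIntegrable
        (fun x => f x * T.hat a x + b * deriv (T.hat a) x * uh x) volume l r :=
      intervalIntegrable_of_Ioo hlr.le ((T.integrableOn_mul_hat hlr hf a).add
        (T.integrableOn_deriv_hat_mul hlr huh b a))
    exact (intervalIntegrable_iff_integrableOn_Ioo_of_le hlr.le).1
      (hi.mul_continuousOn hvc.continuousOn)
  -- The terms with `u_h` cancel, since the derivatives of the hats sum to zero.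
  have hsum : ∫ x in Ioo l r, f x * v x
      = ∑ a, ∫ x in Ioo l r, (f x * T.hat a x + b * deriv (T.hat a) x * uh x) * v x := by
    rw [← integral_finsetSum _ hint2]
    refine integral_congr_ae ((T.ae_iff_forall_elem hlr).2 fun i => ?_)
    filter_upwards [ae_restrict_mem measurableSet_Ioo] with x hx
    rw [← Finset.sum_mul, Finset.sum_add_distrib, ← Finset.mul_sum, ← Finset.sum_mul,
      ← Finset.mul_sum, T.sum_hat i (Ioo_subset_Icc_self hx), T.sum_deriv_hat hx]
    ring
  simp only [reconstruction, Finset.sum_mul]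
  rw [integral_finsetSum _ hint1, Finset.mul_sum, hsum, ← Finset.sum_neg_distrib]
  exact Finset.sum_congr rfl fun a _ => hlocal a

theorem exists_outflow_eq {b : ℝ} (hb : b ≠ 0) (l r : ℝ) :
    ∃ e, (e = l ∨ e = r) ∧ outflow b l r = {e} := by
  rcases lt_or_gt_of_ne hb with h | h
  · refine ⟨l, Or.inl rfl, Set.ext fun x => ?_⟩
    simp [outflow, h, h.le]
  · refine ⟨r, Or.inr rfl, Set.ext fun x => ?_⟩
    simp [outflow, h, h.le]

/-- If `ψ_a f` is a piecewise polynomial for all vertices `a`, the reconstruction is the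
ultra-weak solution. -/
theorem reconstruction_ae_eq (hlr : l < r) {b : ℝ} (hb : b ≠ 0) {f u uh : ℝ → ℝ}
    (hf : InL2 (Ioo l r) f) (hu : IsUltraWeakSolution b l r f u) {k k' : ℕ} (hk : k ≤ k')
    (huh : T.InPh k uh) (horth : T.HatOrthogonal b f uh) {s : Fin (T.n + 1) → ℝ → ℝ}
    (hs : ∀ a, T.IsLocalSolution b f uh k' a (s a))
    (hψf : ∀ a, T.InYh k' a (fun x => T.hat a x * f x)) :
    ∀ᵐ x ∂volume.restrict (Ioo l r), u x = T.reconstruction s x := by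
  have hR : InL2 (Ioo l r) (T.reconstruction s) :=
    inL2_of_continuousOn (T.continuousOn_reconstruction hlr fun a => (hs a).1)
  have hae : ∀ᵐ x : ℝ, x ∈ Ioo l r → u x - T.reconstruction s x = 0 := by
    refine isOpen_Ioo.ae_eq_zero_of_integral_contDiff_smul_eq_zero
      (hu.1.integrableOn.sub hR.integrableOn).locallyIntegrableOn fun χ hχ hχc hχs => ?_
    -- The primitive of `χ` based at the outflow end `e` is an admissible test function with
    -- derivative `χ`; comparing the equations of `u` and `s_h` gives `∫ (u - s_h) χ = 0`.
    obtain ⟨e, -, he⟩ := exists_outflow_eq hb l r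
    have hder := hasDerivAt_primitive hχ.continuous e
    have hv : ∀ x ∈ outflow b l r, ∫ t in e..x, χ t = 0 := fun x hx => by
      rw [he, mem_singleton_iff] at hx
      rw [hx, intervalIntegral.integral_same]
    have h1 := hu.2 _ χ ⟨isH1_of_hasDerivAt hlr hder hχ.continuous, hv⟩
    have h2 := T.integral_reconstruction_mul hlr hb hf hk huh horth hs hψf hder hχ.continuous hv
    have hχL2 : InL2 (Ioo l r) χ := inL2_of_continuousOn hχ.continuous.continuousOn
    have h3 : ip (Ioo l r) u (fun x => b * χ x) = b * ∫ x in Ioo l r, u x * χ x := by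
      rw [ip, ← integral_const_mul]
      congr 1
      ext x
      ring
    have h4 : ∫ x in Ioo l r, u x * χ x = ∫ x in Ioo l r, T.reconstruction s x * χ x := by
      refine mul_left_cancel₀ hb ?_
      rw [h2, ← h3, ← neg_eq_iff_eq_neg, h1, ip]
    have h5 : ∫ x, χ x • (u x - T.reconstruction s x)
        = ∫ x in Ioo l r, χ x • (u x - T.reconstruction s x) :=
      (setIntegral_eq_integral_of_forall_compl_eq_zero fun x hx => by
        rw [image_eq_zero_of_notMem_tsupport (fun h' => hx (hχs h')), zero_smul]).symm
    rw [h5, ← sub_eq_zero.2 h4,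
      ← integral_sub (f := fun x => u x * χ x) (g := fun x => T.reconstruction s x * χ x)
        (hu.1.integrable_mul hχL2) (hR.integrable_mul hχL2)]
    congr 1
    ext x
    rw [smul_eq_mul]
    ring
  rw [ae_restrict_iff' measurableSet_Ioo]
  exact hae.mono fun x hx hx' => sub_eq_zero.1 (hx hx')

/-! ### The constants in the estimate. -/

theorem isPFConstant_one (hlr : l < r) {b : ℝ} (hb : b ≠ 0) (a : Fin (T.n + 1)) :
    T.IsPFConstant b a 1 := by
  rintro v g ⟨hv, hmean, htrace⟩
  have hlt := T.patchLeft_lt_patchRight hlr a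
  rw [mul_one]
  refine hv.nrm_le_of_exists_eq_zero hlt ?_
  -- A zero of `v` on the closed patch is provided by the trace condition or by the zero mean.
  by_cases ha : T.node a ∈ outflow b l r
  · obtain ⟨e, he, hout⟩ := exists_outflow_eq hb (T.patchLeft a) (T.patchRight a)
    refine ⟨e, ?_, htrace ha e (by rw [hout]; rfl)⟩
    rcases he with rfl | rfl
    · exact left_mem_Icc.2 hlt.le
    · exact right_mem_Icc.2 hlt.le
  · exact exists_eq_zero_of_integral_eq_zero hlt hv.cont (by simpa [ip, patch] using hmean ha)

/-- The inequality is tested with `x - c`, whose gradient has positive norm; `c` is the midpoint of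
the patch (zero mean) or its outflow end (zero trace). -/
theorem IsPFConstant.nonneg (hlr : l < r) {b : ℝ} (hb : b ≠ 0) {a : Fin (T.n + 1)} {C : ℝ}
    (hC : T.IsPFConstant b a C) : 0 ≤ C := by
  have hlt := T.patchLeft_lt_patchRight hlr a
  obtain ⟨e, -, he⟩ := exists_outflow_eq hb (T.patchLeft a) (T.patchRight a)
  obtain ⟨c, hc1, hc2⟩ : ∃ c, (T.node a ∉ outflow b l r → c = (T.patchLeft a + T.patchRight a) / 2)
      ∧ (T.node a ∈ outflow b l r → c = e) := by
    by_cases ha : T.node a ∈ outflow b l r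
    · exact ⟨e, fun h => absurd ha h, fun _ => rfl⟩
    · exact ⟨_, fun _ => rfl, fun h => absurd h ha⟩
  have h := hC (fun x => x - c) (fun _ => 1)
    ⟨isH1_of_hasDerivAt hlt (fun x => (hasDerivAt_id x).sub_const c) continuous_const, fun ha => by
      rw [ip, patch, setIntegral_Ioo_eq hlt.le]
      simp only [mul_one]
      rw [intervalIntegral.integral_sub (by simp) (by simp), integral_id,
        intervalIntegral.integral_const, hc1 ha, smul_eq_mul]
      ring, fun ha x hx => by
      rw [he, mem_singleton_iff] at hx
      exact sub_eq_zero.2 (hx.trans (hc2 ha).symm)⟩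
  have hg : 0 < nrm (T.patch a) (fun _ => 1) := by
    rw [nrm, ip, patch]
    refine Real.sqrt_pos.2 ?_
    rw [setIntegral_const, Real.volume_real_Ioo_of_le hlt.le]
    simpa using hlt
  have hd : 0 < T.patchDiam a := sub_pos.2 hlt
  have h0 : 0 ≤ T.patchDiam a * C * nrm (T.patch a) (fun _ => 1) := (Real.sqrt_nonneg _).trans h
  exact nonneg_of_mul_nonneg_right (nonneg_of_mul_nonneg_left h0 hg) hd

/-- A single vertex suffices. The gradient factor is a `toReal`, hence nonnegative without any
finiteness argument. -/
theorem one_le_Ccont (hlr : l < r) {b : ℝ} (hb : b ≠ 0) {C : Fin (T.n + 1) → ℝ}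
    (hC : ∀ a, T.IsPFConstant b a (C a)) : 1 ≤ T.Ccont C := by
  have h1 : 0 ≤ C 0 * T.patchDiam 0 * T.hatGradSup 0 :=
    mul_nonneg (mul_nonneg (IsPFConstant.nonneg T hlr hb (hC 0))
      (sub_pos.2 (T.patchLeft_lt_patchRight hlr 0)).le) ENNReal.toReal_nonneg
  have h2 : 1 + C 0 * T.patchDiam 0 * T.hatGradSup 0 ≤ T.Ccont C :=
    Finset.le_sup' (fun a => 1 + C a * T.patchDiam a * T.hatGradSup a) (Finset.mem_univ 0)
  linarith

end Mesh

end Advection1D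

end

/-- Global efficiency and maximal overestimation of the reconstruction-based estimator for the
one-dimensional advection problem on `Ω = (l, r)`. -/
theorem lemma7p2 (l r : ℝ) (hlr : l < r) (b : ℝ) (hb : b ≠ 0)
    (T : Advection1D.Mesh l r) (k k' : ℕ) (hk : k ≤ k')
    (f u uh : ℝ → ℝ) (hf : Advection1D.InL2 (Set.Ioo l r) f)
    (hu : Advection1D.IsUltraWeakSolution b l r f u)
    (huh : T.InPh k uh) (horth : T.HatOrthogonal b f uh)
    (s : Fin (T.n + 1) → ℝ → ℝ) (hs : ∀ a, T.IsLocalSolution b f uh k' a (s a))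
    (hψf : ∀ a, T.InYh k' a (fun x => T.hat a x * f x)) :
    (∀ a, T.IsPFConstant b a 1) ∧
    ∀ C : Fin (T.n + 1) → ℝ, (∀ a, T.IsPFConstant b a (C a)) →
      Advection1D.nrm (Set.Ioo l r) (fun x => uh x - T.reconstruction s x)
        ≤ 2 * T.Ccont C * Advection1D.nrm (Set.Ioo l r) (fun x => u x - uh x) := by
  refine ⟨T.isPFConstant_one hlr hb, fun C hC => ?_⟩
  have hexact := T.reconstruction_ae_eq hlr hb hf hu hk huh horth hs hψf
  -- Since `s_h = u` almost everywhere, the estimator equals the error.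
  have heq : Advection1D.nrm (Set.Ioo l r) (fun x => uh x - T.reconstruction s x)
      = Advection1D.nrm (Set.Ioo l r) (fun x => u x - uh x) := by
    rw [Advection1D.nrm, Advection1D.nrm, Advection1D.ip, Advection1D.ip]
    congr 1
    refine integral_congr_ae ?_
    filter_upwards [hexact] with x hx
    rw [hx]
    ring
  rw [heq]
  have h1 := T.one_le_Ccont hlr hb hC
  exact le_mul_of_one_le_left (Real.sqrt_nonneg _) (by linarith)
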